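/- Let $M(\phi,\xi,\eta,g_M)$ be a cosymplectic manifold of dimension $2m+1$, that is, a smooth Riemannian manifold with a smooth $(1,1)$-tensor field $\phi$, a smooth vector field $\xi$ and a smooth $1$-form $\eta$ such that $\phi^2=-I+\eta\otimes\xi$, $\phi\xi=0$, $\eta\circ\phi=0$, $\eta(\xi)=1$, $g_M(\phi X,\phi Y)=g_M(X,Y)-\eta(X)\eta(Y)$, $\eta(X)=g_M(X,\xi)$, which is normal, i.e. $[\phi,\phi]+2\,d\eta\otimes\xi=0$ with $[\phi,\phi]$ the Nijenhuis tensor of $\phi$, and for which the forms $\eta$ and $\Phi(X,Y)=g_M(X,\phi Y)$ are closed. Let $(N,g_N)$ be a Riemannian manifold and let $F:M\to N$ be an anti-invariant Riemannian submersion, that is, a smooth surjective submersion such that $F_*$ preserves the lengths of horizontal vectors (those in $(\ker F_*)^\perp$) and $\phi(\ker F_*)\subseteq(\ker F_*)^\perp$. Suppose moreover that $\phi(\ker F_*)=(\ker F_*)^\perp$. Let $\nabla$ be the Levi-Civita connection of $g_M$, let $\mathcal V$ and $\mathcal H$ be the orthogonal projections onto $\ker F_*$ and $(\ker F_*)^\perp$,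 and let $$\mathcal T_EG=\mathcal H\nabla_{\mathcal VE}\mathcal VG+\mathcal V\nabla_{\mathcal VE}\mathcal HG,\qquad \mathcal A_EG=\mathcal V\nabla_{\mathcal HE}\mathcal HG+\mathcal H\nabla_{\mathcal HE}\mathcal VG$$ be O'Neill's tensors. Then $F$ is a totally geodesic map, i.e. $(\nabla F_*)(X,Y)=\nabla^F_X F_*Y-F_*(\nabla_XY)=0$ for all smooth vector fields $X,Y$ on $M$, where $\nabla^F$ is the pullback to $F^{-1}TN$ of the Levi-Civita connection of $g_N$, if and only if $$\mathcal T_W\phi V=0\quad\text{for all } W,V\in\Gamma(\ker F_*)$$ and $$\mathcal A_X\phi W=0\quad\text{for all } X\in\Gamma((\ker F_*)^\perp),\ W\in\Gamma(\ker F_*).$$ -/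

import Mathlib

open Bundle
open scoped Manifold ContDiff Topology

noncomputable section

namespace RiemGeom

section VectorFields

variable {E : Type*} [NormedAddCommGroup E] [NormedSpace ℝ E]
  {H : Type*} [TopologicalSpace H] (I : ModelWithCorners ℝ E H)
  {M : Type*} [TopologicalSpace M] [ChartedSpace H M]

/-- `X` is a `C^∞` vector field on `M`. -/
def IsSmoothField [IsManifold I ∞ M] (X : Π x : M, TangentSpace I x) : Prop :=
  ContMDiff I I.tangent ∞ (fun x ↦ (⟨x, X x⟩ : TangentBundle I M))

instance instFiniteDimensionalTangentSpace [FiniteDimensional ℝ E] (x : M) :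
    FiniteDimensional ℝ (TangentSpace I x) :=
  inferInstanceAs (FiniteDimensional ℝ E)

end VectorFields

/-! ### The Levi-Civita connection of a Riemannian manifold -/

section LeviCivita

variable {E : Type*} [NormedAddCommGroup E] [NormedSpace ℝ E]
  {H : Type*} [TopologicalSpace H] (I : ModelWithCorners ℝ E H)
  {M : Type*} [TopologicalSpace M] [ChartedSpace H M] [IsManifold I ∞ M]
  [RiemannianBundle (fun x : M ↦ TangentSpace I x)]

/-- The right-hand side of the Koszul formula for `2 ⟨∇_X Y, Z⟩`. -/
def koszul (X Y Z : Π x : M, TangentSpace I x) (x : M) : ℝ :=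
  mvfderiv I (fun y ↦ inner ℝ (Y y) (Z y)) x (X x)
    + mvfderiv I (fun y ↦ inner ℝ (Z y) (X y)) x (Y x)
    - mvfderiv I (fun y ↦ inner ℝ (X y) (Y y)) x (Z x)
    + inner ℝ (VectorField.mlieBracket I X Y x) (Z x)
    - inner ℝ (VectorField.mlieBracket I Y Z x) (X x)
    + inner ℝ (VectorField.mlieBracket I Z X x) (Y x)

variable [IsContMDiffRiemannianBundle I ∞ E (fun x : M ↦ TangentSpace I x)]

theorem mdifferentiableAt_inner {X Y : Π x : M, TangentSpace I x} {x : M}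
    (hX : MDiffAt (T% X) x) (hY : MDiffAt (T% Y) x) :
    MDiffAt (fun y ↦ (inner ℝ (X y) (Y y) : ℝ)) x :=
  MDifferentiableAt.inner_bundle (IB := I) (F := E) (E := fun x : M ↦ TangentSpace I x) hX hY

variable [CompleteSpace E]


theorem koszul_tensorial_left {Y Z : Π x : M, TangentSpace I x} {x : M}
    (hY : MDiffAt (T% Y) x) (hZ : MDiffAt (T% Z) x) :
    TensorialAt I E (fun X ↦ koszul I X Y Z x) x where
  smul {f X} hf hX := by
    simp [koszul, inner_smul_left, inner_smul_right, mvfderiv_fun_mul hf (mdifferentiableAt_inner I hZ hX),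
      mvfderiv_fun_mul hf (mdifferentiableAt_inner I hY hX), VectorField.mlieBracket_smul_left hf hX,
      VectorField.mlieBracket_smul_right hf hX, inner_add_left, real_inner_comm]
    ring
  add {X X'} hX hX' := by
    simp [koszul, inner_add_left, inner_add_right,
      mvfderiv_fun_add (mdifferentiableAt_inner I hZ hX) (mdifferentiableAt_inner I hZ hX'),
      mvfderiv_fun_add (mdifferentiableAt_inner I hX hY) (mdifferentiableAt_inner I hX' hY),
      VectorField.mlieBracket_add_left hX hX',
      VectorField.mlieBracket_add_right hX hX']
    ring

theorem koszul_tensorial_right {X Y : Π x : M, TangentSpace I x} {x : M}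
    (hX : MDiffAt (T% X) x) (hY : MDiffAt (T% Y) x) :
    TensorialAt I E (fun Z ↦ koszul I X Y Z x) x where
  smul {f Z} hf hZ := by
    simp [koszul, inner_smul_left, inner_smul_right, mvfderiv_fun_mul hf (mdifferentiableAt_inner I hX hZ),
      mvfderiv_fun_mul hf (mdifferentiableAt_inner I hY hZ), VectorField.mlieBracket_smul_left hf hZ,
      VectorField.mlieBracket_smul_right hf hZ, inner_add_left, real_inner_comm]
    ring
  add {Z Z'} hZ hZ' := by
    simp [koszul, inner_add_left, inner_add_right,
      mvfderiv_fun_add (mdifferentiableAt_inner I hZ hX) (mdifferentiableAt_inner I hZ' hX),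
      mvfderiv_fun_add (mdifferentiableAt_inner I hY hZ) (mdifferentiableAt_inner I hY hZ'),
      VectorField.mlieBracket_add_left hZ hZ',
      VectorField.mlieBracket_add_right hZ hZ']
    ring

theorem koszul_add_mid {X Y Y' Z : Π x : M, TangentSpace I x} {x : M}
    (hX : MDiffAt (T% X) x) (hY : MDiffAt (T% Y) x) (hY' : MDiffAt (T% Y') x)
    (hZ : MDiffAt (T% Z) x) :
    koszul I X (Y + Y') Z x = koszul I X Y Z x + koszul I X Y' Z x := by
  simp [koszul, inner_add_left, inner_add_right,
      mvfderiv_fun_add (mdifferentiableAt_inner I hX hY) (mdifferentiableAt_inner I hX hY'),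
      mvfderiv_fun_add (mdifferentiableAt_inner I hY hZ) (mdifferentiableAt_inner I hY' hZ),
      VectorField.mlieBracket_add_left hY hY',
      VectorField.mlieBracket_add_right hY hY']
  ring

theorem koszul_smul_mid {X Y Z : Π x : M, TangentSpace I x} {f : M → ℝ} {x : M}
    (hX : MDiffAt (T% X) x) (hY : MDiffAt (T% Y) x) (hf : MDiffAt f x)
    (hZ : MDiffAt (T% Z) x) :
    koszul I X (f • Y) Z x =
      f x * koszul I X Y Z x + 2 * (mvfderiv I f x (X x) * inner ℝ (Y x) (Z x)) := by
  simp [koszul, inner_smul_left, inner_smul_right, mvfderiv_fun_mul hf (mdifferentiableAt_inner I hX hY),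
      mvfderiv_fun_mul hf (mdifferentiableAt_inner I hY hZ), VectorField.mlieBracket_smul_left hf hY,
      VectorField.mlieBracket_smul_right hf hY, inner_add_left, real_inner_comm]
  ring

variable [FiniteDimensional ℝ E]

open scoped Classical in
/-- For a vector field `Y` differentiable at `x`, the bilinear form `(v, w) ↦ ⟨∇_v Y, w⟩` on the
tangent space at `x`, given by the Koszul formula. -/
def koszulForm (Y : Π x : M, TangentSpace I x) (x : M) :
    TangentSpace I x →L[ℝ] TangentSpace I x →L[ℝ] ℝ :=
  if hY : MDiffAt (T% Y) x then
    (1 / 2 : ℝ) • TensorialAt.mkHom₂ (I := I) (F := E) (F' := E) (fun X Z ↦ koszul I X Y Z x) x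
      (fun _ hZ ↦ koszul_tensorial_left I hY hZ) (fun _ hX ↦ koszul_tensorial_right I hX hY)
  else 0

theorem koszulForm_apply {X Y Z : Π x : M, TangentSpace I x} {x : M}
    (hX : MDiffAt (T% X) x) (hY : MDiffAt (T% Y) x) (hZ : MDiffAt (T% Z) x) :
    koszulForm I Y x (X x) (Z x) = 1 / 2 * koszul I X Y Z x := by
  rw [koszulForm, dif_pos hY]
  simp only [smul_apply, smul_eq_mul]
  rw [TensorialAt.mkHom₂_apply (I := I) (F := E) (F' := E)
      (fun _ hZ ↦ koszul_tensorial_left I hY hZ) (fun _ hX ↦ koszul_tensorial_right I hX hY) hX hZ]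

/-- `∇ Y` at `x`, as an endomorphism of the tangent space: `∇_v Y` is the vector representing
the linear form `w ↦ ⟨∇_v Y, w⟩` of the Koszul formula. -/
def leviCivitaAux (Y : Π x : M, TangentSpace I x) (x : M) :
    TangentSpace I x →L[ℝ] TangentSpace I x :=
  LinearMap.toContinuousLinearMap
    { toFun := fun v ↦
        haveI : CompleteSpace (TangentSpace I x) := FiniteDimensional.complete ℝ _
        (InnerProductSpace.toDual ℝ (TangentSpace I x)).symm (koszulForm I Y x v)
      map_add' := by simp
      map_smul' := by simp }

theorem inner_leviCivitaAux (Y : Π x : M, TangentSpace I x) (x : M) (v w : TangentSpace I x) :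
    inner ℝ (leviCivitaAux I Y x v) w = koszulForm I Y x v w := by
  have : CompleteSpace (TangentSpace I x) := FiniteDimensional.complete ℝ _
  exact InnerProductSpace.toDual_symm_apply

/-- The Levi-Civita connection: `leviCivita I Y x v` is `∇_v Y` at `x`. -/
def leviCivita : CovariantDerivative I E (TangentSpace I : M → Type _) where
  toFun := leviCivitaAux I
  isCovariantDerivativeOnUniv :=
    { add := by
        intro Y Y' x hY hY' _
        ext v
        refine ext_inner_right ℝ fun w ↦ ?_
        have hv := FiberBundle.mdifferentiableAt_extend I E v
        have hw := FiberBundle.mdifferentiableAt_extend I E w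
        rw [add_apply, inner_add_left, inner_leviCivitaAux,
          inner_leviCivitaAux, inner_leviCivitaAux, ← FiberBundle.extend_apply_self E v,
          ← FiberBundle.extend_apply_self E w,
          koszulForm_apply I hv (mdifferentiableAt_add_section hY hY') hw,
          koszulForm_apply I hv hY hw, koszulForm_apply I hv hY' hw,
          koszul_add_mid I hv hY hY' hw]
        ring
      leibniz := by
        intro Y f x hY hf _
        ext v
        refine ext_inner_right ℝ fun w ↦ ?_
        have hv := FiberBundle.mdifferentiableAt_extend I E v
        have hw := FiberBundle.mdifferentiableAt_extend I E w
        have key := koszul_smul_mid I hv hY hf hw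
        have h1 := koszulForm_apply I hv (hf.smul_section hY) hw
        have h2 := koszulForm_apply I hv hY hw
        rw [FiberBundle.extend_apply_self, FiberBundle.extend_apply_self] at h1 h2 key
        rw [add_apply, smul_apply,
          ContinuousLinearMap.smulRight_apply, inner_add_left, inner_smul_left, inner_smul_left,
          inner_leviCivitaAux, inner_leviCivitaAux, h2]
        erw [h1]
        rw [key]
        simp
        ring }

theorem inner_leviCivita {X Y Z : Π x : M, TangentSpace I x} {x : M}
    (hX : MDiffAt (T% X) x) (hY : MDiffAt (T% Y) x) (hZ : MDiffAt (T% Z) x) :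
    inner ℝ (leviCivita I Y x (X x)) (Z x) = 1 / 2 * koszul I X Y Z x :=
  (inner_leviCivitaAux I Y x (X x) (Z x)).trans (koszulForm_apply I hX hY hZ)

/-- The Levi-Civita connection is torsion-free. -/
theorem leviCivita_torsion :
    (leviCivita I : CovariantDerivative I E (TangentSpace I : M → Type _)).torsion = 0 := by
  rw [CovariantDerivative.torsion_eq_zero_iff]
  intro X Y x hX hY
  refine ext_inner_right ℝ fun w ↦ ?_
  have hw := FiberBundle.mdifferentiableAt_extend I E w
  have h1 := inner_leviCivita I hX hY hw
  have h2 := inner_leviCivita I hY hX hw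
  rw [FiberBundle.extend_apply_self] at h1 h2
  rw [inner_sub_left, h1, h2]
  simp only [koszul, FiberBundle.extend_apply_self, real_inner_comm,
    VectorField.mlieBracket_swap_apply (V := Y) (W := X),
    VectorField.mlieBracket_swap_apply (V := X) (W := FiberBundle.extend E w),
    VectorField.mlieBracket_swap_apply (V := Y) (W := FiberBundle.extend E w),
    inner_neg_left]
  ring

/-- The Levi-Civita connection is compatible with the metric. -/
theorem leviCivita_metric {X Y Z : Π x : M, TangentSpace I x} {x : M}
    (hX : MDiffAt (T% X) x) (hY : MDiffAt (T% Y) x) (hZ : MDiffAt (T% Z) x) :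
    mvfderiv I (fun y ↦ inner ℝ (Y y) (Z y)) x (X x) =
      inner ℝ (leviCivita I Y x (X x)) (Z x) + inner ℝ (Y x) (leviCivita I Z x (X x)) := by
  rw [real_inner_comm _ (Y x), inner_leviCivita I hX hY hZ, inner_leviCivita I hX hZ hY]
  simp only [koszul, real_inner_comm,
    VectorField.mlieBracket_swap_apply (V := Y) (W := X),
    VectorField.mlieBracket_swap_apply (V := Z) (W := X),
    VectorField.mlieBracket_swap_apply (V := Z) (W := Y),
    inner_neg_left]
  ring

end LeviCivita
/-! ### Almost contact metric structures and cosymplectic manifolds -/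

section AlmostContact

variable {E : Type*} [NormedAddCommGroup E] [NormedSpace ℝ E]
  {H : Type*} [TopologicalSpace H] (I : ModelWithCorners ℝ E H)
  (M : Type*) [TopologicalSpace M] [ChartedSpace H M] [IsManifold I ∞ M]
  [RiemannianBundle (fun x : M ↦ TangentSpace I x)]

/-- An almost contact metric structure `(φ, ξ, η, g)` on the Riemannian manifold `(M, g)`:
a smooth `(1,1)`-tensor field `φ`, a smooth vector field `ξ` and a smooth `1`-form `η`. -/
structure AlmostContactMetricStructure where
  /-- The `(1,1)`-tensor field `φ`. -/
  phi : Π x : M, TangentSpace I x →L[ℝ] TangentSpace I x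
  /-- The characteristic vector field `ξ`. -/
  xi : Π x : M, TangentSpace I x
  /-- The `1`-form `η`. -/
  eta : Π x : M, TangentSpace I x →L[ℝ] ℝ
  contMDiff_phi : ContMDiff I (I.prod 𝓘(ℝ, E →L[ℝ] E)) ∞
    (fun x ↦ (⟨x, phi x⟩ :
      TotalSpace (E →L[ℝ] E) (fun x : M ↦ TangentSpace I x →L[ℝ] TangentSpace I x)))
  isSmoothField_xi : IsSmoothField I xi
  contMDiff_eta : ContMDiff I (I.prod 𝓘(ℝ, E →L[ℝ] ℝ)) ∞
    (fun x ↦ (⟨x, eta x⟩ : TotalSpace (E →L[ℝ] ℝ) (fun x : M ↦ TangentSpace I x →L[ℝ] ℝ)))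
  phi_phi : ∀ x v, phi x (phi x v) = -v + eta x v • xi x
  phi_xi : ∀ x, phi x (xi x) = 0
  eta_phi : ∀ x v, eta x (phi x v) = 0
  eta_xi : ∀ x, eta x (xi x) = 1
  inner_phi_phi : ∀ x v w, inner ℝ (phi x v) (phi x w) = inner ℝ v w - eta x v * eta x w
  eta_eq_inner : ∀ x v, eta x v = inner ℝ v (xi x)

namespace AlmostContactMetricStructure

variable {I M} (S : AlmostContactMetricStructure I M)

/-- The vector field `φ X`. -/
def phiField (X : Π x : M, TangentSpace I x) : Π x : M, TangentSpace I x :=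
  fun x ↦ S.phi x (X x)

/-- The fundamental `2`-form `Φ(X, Y) = g(X, φ Y)`. -/
def fundamentalForm (X Y : Π x : M, TangentSpace I x) (x : M) : ℝ :=
  inner ℝ (X x) (S.phi x (Y x))

/-- The exterior derivative of `η`, in the normalization
`2 dη(X, Y) = X η(Y) - Y η(X) - η([X, Y])`. -/
def dEta (X Y : Π x : M, TangentSpace I x) (x : M) : ℝ :=
  (1 / 2) * (mvfderiv I (fun y ↦ S.eta y (Y y)) x (X x)
    - mvfderiv I (fun y ↦ S.eta y (X y)) x (Y x)
    - S.eta x (VectorField.mlieBracket I X Y x))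

/-- The exterior derivative of `Φ`, in the normalization
`3 dΦ(X, Y, Z) = X Φ(Y, Z) + Y Φ(Z, X) + Z Φ(X, Y) - Φ([X, Y], Z) - Φ([Y, Z], X) - Φ([Z, X], Y)`. -/
def dFundamentalForm (X Y Z : Π x : M, TangentSpace I x) (x : M) : ℝ :=
  (1 / 3) * (mvfderiv I (S.fundamentalForm Y Z) x (X x)
    + mvfderiv I (S.fundamentalForm Z X) x (Y x)
    + mvfderiv I (S.fundamentalForm X Y) x (Z x)
    - S.fundamentalForm (VectorField.mlieBracket I X Y) Z x
    - S.fundamentalForm (VectorField.mlieBracket I Y Z) X x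
    - S.fundamentalForm (VectorField.mlieBracket I Z X) Y x)

/-- The Nijenhuis tensor
`[φ, φ](X, Y) = φ² [X, Y] + [φ X, φ Y] - φ [φ X, Y] - φ [X, φ Y]`. -/
def nijenhuis (X Y : Π x : M, TangentSpace I x) (x : M) : TangentSpace I x :=
  S.phi x (S.phi x (VectorField.mlieBracket I X Y x))
    + VectorField.mlieBracket I (S.phiField X) (S.phiField Y) x
    - S.phi x (VectorField.mlieBracket I (S.phiField X) Y x)
    - S.phi x (VectorField.mlieBracket I X (S.phiField Y) x)

/-- Normality: `[φ, φ] + 2 dη ⊗ ξ = 0`. -/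
def IsNormal : Prop :=
  ∀ X Y : Π x : M, TangentSpace I x, IsSmoothField I X → IsSmoothField I Y →
    ∀ x, S.nijenhuis X Y x + (2 * S.dEta X Y x) • S.xi x = 0

/-- A cosymplectic structure: a normal almost contact metric structure such that both `Φ` and `η`
are closed. -/
structure IsCosymplectic : Prop where
  isNormal : S.IsNormal
  closed_fundamentalForm : ∀ X Y Z : Π x : M, TangentSpace I x,
    IsSmoothField I X → IsSmoothField I Y → IsSmoothField I Z →
      ∀ x, S.dFundamentalForm X Y Z x = 0
  closed_eta : ∀ X Y : Π x : M, TangentSpace I x, IsSmoothField I X → IsSmoothField I Y →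
    ∀ x, S.dEta X Y x = 0

end AlmostContactMetricStructure

end AlmostContact

/-! ### Riemannian submersions, O'Neill's tensors, the second fundamental form of a map -/

section Submersion

variable {E : Type*} [NormedAddCommGroup E] [NormedSpace ℝ E] [FiniteDimensional ℝ E]
  {H : Type*} [TopologicalSpace H] (I : ModelWithCorners ℝ E H)
  {M : Type*} [TopologicalSpace M] [ChartedSpace H M] [IsManifold I ∞ M]
  {E' : Type*} [NormedAddCommGroup E'] [NormedSpace ℝ E']
  {H' : Type*} [TopologicalSpace H'] (J : ModelWithCorners ℝ E' H')
  {N : Type*} [TopologicalSpace N] [ChartedSpace H' N] [IsManifold J ∞ N]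
  (F : M → N)

/-- The vertical space `ker F_*` at `x`. -/
def verticalSpace (x : M) : Submodule ℝ (TangentSpace I x) :=
  (mfderiv I J F x).ker

variable [RiemannianBundle (fun x : M ↦ TangentSpace I x)]

/-- The horizontal space `(ker F_*)ᗮ` at `x`. -/
def horizontalSpace (x : M) : Submodule ℝ (TangentSpace I x) :=
  (verticalSpace I J F x)ᗮ

instance (x : M) : (horizontalSpace I J F x).HasOrthogonalProjection :=
  inferInstanceAs (verticalSpace I J F x)ᗮ.HasOrthogonalProjection

/-- `V ∈ Γ(ker F_*)`. -/
structure IsVerticalField (V : Π x : M, TangentSpace I x) : Prop where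
  smooth : IsSmoothField I V
  mem : ∀ x, V x ∈ verticalSpace I J F x

/-- `X ∈ Γ((ker F_*)ᗮ)`. -/
structure IsHorizontalField (X : Π x : M, TangentSpace I x) : Prop where
  smooth : IsSmoothField I X
  mem : ∀ x, X x ∈ horizontalSpace I J F x

/-- The vertical part `𝒱 X` of a vector field. -/
def verticalPart (X : Π x : M, TangentSpace I x) : Π x : M, TangentSpace I x :=
  fun x ↦ (verticalSpace I J F x).starProjection (X x)

/-- The horizontal part `ℋ X` of a vector field. -/
def horizontalPart (X : Π x : M, TangentSpace I x) : Π x : M, TangentSpace I x :=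
  fun x ↦ (horizontalSpace I J F x).starProjection (X x)

/-- A Riemannian submersion: a smooth surjective map whose differential is everywhere onto and
preserves the lengths of horizontal vectors. -/
structure IsRiemannianSubmersion [RiemannianBundle (fun y : N ↦ TangentSpace J y)] : Prop where
  contMDiff : ContMDiff I J ∞ F
  surjective : Function.Surjective F
  surjective_mfderiv : ∀ x, Function.Surjective (mfderiv I J F x)
  norm_mfderiv : ∀ x, ∀ v ∈ horizontalSpace I J F x, ‖mfderiv I J F x v‖ = ‖v‖

section ONeill

variable [CompleteSpace E] [IsContMDiffRiemannianBundle I ∞ E (fun x : M ↦ TangentSpace I x)]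

/-- The vector field `∇_X Y`. -/
def nabla (X Y : Π x : M, TangentSpace I x) : Π x : M, TangentSpace I x :=
  fun x ↦ leviCivita I Y x (X x)

/-- O'Neill's tensor `T_X Y = ℋ ∇_{𝒱 X} 𝒱 Y + 𝒱 ∇_{𝒱 X} ℋ Y`. -/
def oneillT (X Y : Π x : M, TangentSpace I x) : Π x : M, TangentSpace I x :=
  horizontalPart I J F (nabla I (verticalPart I J F X) (verticalPart I J F Y))
    + verticalPart I J F (nabla I (verticalPart I J F X) (horizontalPart I J F Y))

/-- O'Neill's tensor `A_X Y = 𝒱 ∇_{ℋ X} ℋ Y + ℋ ∇_{ℋ X} 𝒱 Y`. -/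
def oneillA (X Y : Π x : M, TangentSpace I x) : Π x : M, TangentSpace I x :=
  verticalPart I J F (nabla I (horizontalPart I J F X) (horizontalPart I J F Y))
    + horizontalPart I J F (nabla I (horizontalPart I J F X) (verticalPart I J F Y))

end ONeill

/-- An anti-invariant Riemannian submersion: `φ (ker F_*) ⊆ (ker F_*)ᗮ`. -/
structure IsAntiInvariantRiemannianSubmersion
    [RiemannianBundle (fun y : N ↦ TangentSpace J y)]
    (S : AlmostContactMetricStructure I M) : Prop where
  isRiemannianSubmersion : IsRiemannianSubmersion I J F
  map_phi_le : ∀ x, ∀ v ∈ verticalSpace I J F x, S.phi x v ∈ horizontalSpace I J F x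

end Submersion

section SecondFundamentalForm

variable {E : Type*} [NormedAddCommGroup E] [NormedSpace ℝ E]
  {H : Type*} [TopologicalSpace H] (I : ModelWithCorners ℝ E H)
  {M : Type*} [TopologicalSpace M] [ChartedSpace H M]
  {E' : Type*} [NormedAddCommGroup E'] [NormedSpace ℝ E'] [FiniteDimensional ℝ E']
  [CompleteSpace E']
  {H' : Type*} [TopologicalSpace H'] (J : ModelWithCorners ℝ E' H')
  {N : Type*} [TopologicalSpace N] [ChartedSpace H' N] [IsManifold J ∞ N]
  [RiemannianBundle (fun y : N ↦ TangentSpace J y)]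
  [IsContMDiffRiemannianBundle J ∞ E' (fun y : N ↦ TangentSpace J y)]
  (F : M → N)

/-- The pullback to `F⁻¹ TN` of the Levi-Civita connection of `N`: the derivative `∇^F_v s` at `p`
of a section `s` of `F⁻¹ TN`. In a local frame `e₁, …, eₙ` of `TN` around `F p`, with
`s = ∑ sⁱ (eᵢ ∘ F)` near `p`, it is `∑ (dsⁱ(v) eᵢ(F p) + sⁱ(p) ∇_{F_* v} eᵢ)`. Here the frame is
the one of the chart at `F p`, and `∑ sⁱ(p) eᵢ` is the extension `FiberBundle.extend E' (s p)`
of `s p` with constant coefficients. -/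
def pullbackNabla (s : Π q : M, TangentSpace J (F q)) (p : M) (v : TangentSpace I p) :
    TangentSpace J (F p) :=
  let e := trivializationAt E' (TangentSpace J : N → Type _) (F p)
  e.symmL ℝ (F p)
      (mvfderiv I (fun q ↦ (e (⟨F q, s q⟩ : TotalSpace E' (TangentSpace J : N → Type _))).2) p v)
    + leviCivita J (FiberBundle.extend E' (s p)) (F p) (mfderiv I J F p v)

/-- The derivative `∇^F` of a vector field along `F` of the form `Y ∘ F` is `∇_{F_* v} Y`. -/
theorem pullbackNabla_comp {Y : Π y : N, TangentSpace J y} {p : M} (hF : MDiffAt F p)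
    (hY : MDiffAt (T% Y) (F p)) (v : TangentSpace I p) :
    pullbackNabla I J F (fun q ↦ Y (F q)) p v = leviCivita J Y (F p) (mfderiv I J F p v) := by
  let e := trivializationAt E' (TangentSpace J : N → Type _) (F p)
  have hmem : F p ∈ e.baseSet := FiberBundle.mem_baseSet_trivializationAt' (F p)
  let w : TangentSpace J (F p) := mfderiv I J F p v
  let c : (Π y : N, TangentSpace J y) → N → E' := fun Z y ↦
    (e (⟨y, Z y⟩ : TotalSpace E' (TangentSpace J : N → Type _))).2
  have hc : ∀ Z : Π y : N, TangentSpace J y, MDiffAt (T% Z) (F p) → MDiffAt (c Z) (F p) :=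
    fun Z hZ ↦ (mdifferentiableAt_section J Z).1 hZ
  have hnear : ∀ᶠ y in 𝓝 (F p), y ∈ e.baseSet := e.open_baseSet.mem_nhds hmem
  have htens : TensorialAt J E' (fun Z : Π y : N, TangentSpace J y ↦
      leviCivita J Z (F p) w - e.symmL ℝ (F p) (mvfderiv J (c Z) (F p) w)) (F p) := by
    constructor
    · intro f Z hf hZ
      have h1 : c (f • Z) =ᶠ[𝓝 (F p)] f • c Z := by
        filter_upwards [hnear] with y hy
        exact (e.linear ℝ hy).map_smul (f y) (Z y)
      have h2 : e.symmL ℝ (F p) (c Z (F p)) = Z (F p) := by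
        rw [e.symmL_apply hmem]
        exact e.symm_apply_apply_mk hmem (Z (F p))
      have h3 : mvfderiv J (c (f • Z)) (F p) = mvfderiv J (f • c Z) (F p) := by
        ext u
        simp only [mvfderiv, h1.mfderiv_eq, ContinuousLinearMap.comp_apply]
        rfl
      rw [h3, mvfderiv_smul hf (hc Z hZ),
        (leviCivita J).isCovariantDerivativeOnUniv.leibniz hZ hf]
      simp [h2, smul_sub]
    · intro Z Z' hZ hZ'
      have h1 : c (Z + Z') =ᶠ[𝓝 (F p)] c Z + c Z' := by
        filter_upwards [hnear] with y hy
        exact (e.linear ℝ hy).map_add (Z y) (Z' y)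
      have h3 : mvfderiv J (c (Z + Z')) (F p) = mvfderiv J (c Z + c Z') (F p) := by
        ext u
        simp only [mvfderiv, h1.mfderiv_eq, ContinuousLinearMap.comp_apply]
        rfl
      rw [h3, mvfderiv_add (hc Z hZ) (hc Z' hZ'),
        (leviCivita J).isCovariantDerivativeOnUniv.add hZ hZ']
      simp only [add_apply, map_add]
      abel
  have h := htens.pointwise hY (FiberBundle.mdifferentiableAt_extend J E' (Y (F p)))
    (FiberBundle.extend_apply_self E' (Y (F p))).symm
  have h0 : c (FiberBundle.extend E' (Y (F p))) =ᶠ[𝓝 (F p)]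
      fun _ ↦ (e (⟨F p, Y (F p)⟩ : TotalSpace E' (TangentSpace J : N → Type _))).2 := by
    filter_upwards [hnear] with y hy
    have h1 := congrArg Prod.snd
      (e.apply_mk_symm hy (e (⟨F p, Y (F p)⟩ : TotalSpace E' (TangentSpace J : N → Type _))).2)
    exact h1
  have h4 : mvfderiv J (c (FiberBundle.extend E' (Y (F p)))) (F p) = 0 := by
    rw [mvfderiv, h0.mfderiv_eq, mfderiv_const]
    exact ContinuousLinearMap.comp_zero _
  have h5 : mvfderiv I (fun q ↦ c Y (F q)) p v = mvfderiv J (c Y) (F p) w := by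
    have := mfderiv_comp_apply p (hc Y hY) hF v
    exact this
  rw [h4] at h
  simp only [zero_apply, map_zero, sub_zero] at h
  rw [sub_eq_iff_eq_add] at h
  change e.symmL ℝ (F p) (mvfderiv I (fun q ↦ c Y (F q)) p v) + leviCivita J _ (F p) w
    = leviCivita J Y (F p) w
  rw [h, h5, add_comm]

variable [IsManifold I ∞ M] [RiemannianBundle (fun x : M ↦ TangentSpace I x)]
  [FiniteDimensional ℝ E] [CompleteSpace E]
  [IsContMDiffRiemannianBundle I ∞ E (fun x : M ↦ TangentSpace I x)]

/-- The second fundamental form `(∇F_*)(X, Y) = ∇^F_X (F_* Y) - F_* (∇_X Y)`. -/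
def secondFundamentalForm (X Y : Π x : M, TangentSpace I x) (p : M) : TangentSpace J (F p) :=
  pullbackNabla I J F (fun q ↦ mfderiv I J F q (Y q)) p (X p)
    - mfderiv I J F p (nabla I X Y p)

/-- `F` is a totally geodesic map: `∇F_* = 0`. -/
def IsTotallyGeodesicMap : Prop :=
  ∀ X Y : Π x : M, TangentSpace I x, IsSmoothField I X → IsSmoothField I Y →
    ∀ p, secondFundamentalForm I J F X Y p = 0

end SecondFundamentalForm
end RiemGeom
end

noncomputable section

set_option linter.unusedSectionVars false

namespace RiemGeom

section LieBracket

open VectorField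

variable {E : Type*} [NormedAddCommGroup E] [NormedSpace ℝ E] [CompleteSpace E]
  {H : Type*} [TopologicalSpace H] {I : ModelWithCorners ℝ E H} [I.Boundaryless]
  {M : Type*} [TopologicalSpace M] [ChartedSpace H M] [IsManifold I ∞ M]
  {G : Type*} [NormedAddCommGroup G] [NormedSpace ℝ G]

/-- The derivative of a function `k ∘ φ`, where `φ` is the chart at `p`, expressed in the chart. -/
theorem mvfderiv_of_eventuallyEq_comp_extChartAt {f : M → G} {k : E → G} {p q : M}
    (hq : q ∈ (extChartAt I p).source)
    (hk : DifferentiableAt ℝ k (extChartAt I p q)) (hf : f =ᶠ[𝓝 q] k ∘ extChartAt I p)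
    (V : Π x : M, TangentSpace I x) :
    mvfderiv I f q (V q) = fderiv ℝ k (extChartAt I p q)
      (mpullbackWithin 𝓘(ℝ, E) I (extChartAt I p).symm V (Set.range I) (extChartAt I p q)) := by
  have hq' : q ∈ (chartAt H p).source := by rwa [extChartAt_source] at hq
  have h1 : mfderiv I 𝓘(ℝ, G) f q (V q) = mfderiv I 𝓘(ℝ, G) (k ∘ extChartAt I p) q (V q) := by
    rw [hf.mfderiv_eq]
    rfl
  have h2 := mfderiv_comp_apply q hk.mdifferentiableAt (mdifferentiableAt_extChartAt hq') (V q)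
  have h3 : mfderiv I 𝓘(ℝ, E) (extChartAt I p) q (V q) =
      mpullbackWithin 𝓘(ℝ, E) I (extChartAt I p).symm V (Set.range I) (extChartAt I p q) := by
    rw [mpullbackWithin_apply, (extChartAt I p).left_inv hq, eq_comm]
    have hi := isInvertible_mfderivWithin_extChartAt_symm ((extChartAt I p).map_source hq)
    rw [(extChartAt I p).left_inv hq] at hi
    refine (hi.inverse_apply_eq).2 ?_
    have := DFunLike.congr_fun (mfderivWithin_extChartAt_symm_comp_mfderiv_extChartAt' hq) (V q)
    exact this.symm
  rw [mfderiv_eq_fderiv, h3] at h2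
  exact h1.trans h2

theorem contDiffAt_comp_extChartAt_symm {g : M → G} {p : M}
    (hg : ContMDiffAt I 𝓘(ℝ, G) ∞ g p) :
    ContDiffAt ℝ ∞ (g ∘ (extChartAt I p).symm) (extChartAt I p p) := by
  have := contMDiffAt_iff.1 hg |>.2
  rw [I.range_eq_univ, contDiffWithinAt_univ] at this
  exact this

theorem differentiableAt_mpullbackWithin_extChartAt_symm {V : Π x : M, TangentSpace I x} {p : M}
    (hV : MDiffAt (T% V) p) :
    DifferentiableAt ℝ (F := E)
      (mpullbackWithin 𝓘(ℝ, E) I (extChartAt I p).symm V (Set.range I)) (extChartAt I p p) := by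
  have h := (hV.mdifferentiableWithinAt
    (s := Set.univ)).differentiableWithinAt_mpullbackWithin_vectorField
  have hu : (extChartAt I p).symm ⁻¹' Set.univ ∩ Set.range I = Set.univ := by
    simp [I.range_eq_univ]
  rw [hu] at h
  exact differentiableWithinAt_univ.1 h

theorem eventually_eq_comp_extChartAt (g : M → G) (p : M) :
    ∀ᶠ q in 𝓝 p, q ∈ (extChartAt I p).source ∧
      g =ᶠ[𝓝 q] (g ∘ (extChartAt I p).symm) ∘ extChartAt I p := by
  filter_upwards [extChartAt_source_mem_nhds (I := I) p] with q hq
  refine ⟨hq, ?_⟩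
  filter_upwards [(isOpen_extChartAt_source p).mem_nhds hq] with r hr
  simp only [Function.comp_apply, (extChartAt I p).left_inv hr]

theorem eventually_differentiableAt_comp_extChartAt_symm {g : M → G} {p : M}
    (hg : ContMDiffAt I 𝓘(ℝ, G) ∞ g p) :
    ∀ᶠ q in 𝓝 p, DifferentiableAt ℝ (g ∘ (extChartAt I p).symm) (extChartAt I p q) := by
  have h1 : ∀ᶠ y in 𝓝 (extChartAt I p p),
      DifferentiableAt ℝ (g ∘ (extChartAt I p).symm) y := by
    filter_upwards [((contDiffAt_comp_extChartAt_symm hg).of_le (m := 1) (by simp)).eventually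
      (by simp)] with y hy
    exact hy.differentiableAt (by simp)
  exact (continuousAt_extChartAt p).eventually h1

/-- The expression of `V g` in the chart at `p`. -/
theorem mvfderiv_apply_eventuallyEq {g : M → G} {p : M} (hg : ContMDiffAt I 𝓘(ℝ, G) ∞ g p)
    (V : Π x : M, TangentSpace I x) :
    (fun q ↦ mvfderiv I g q (V q)) =ᶠ[𝓝 p]
      (fun y ↦ fderiv ℝ (g ∘ (extChartAt I p).symm) y
        (mpullbackWithin 𝓘(ℝ, E) I (extChartAt I p).symm V (Set.range I) y)) ∘
          extChartAt I p := by
  filter_upwards [eventually_eq_comp_extChartAt (I := I) g p,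
    eventually_differentiableAt_comp_extChartAt_symm hg] with q hq hq'
  exact mvfderiv_of_eventuallyEq_comp_extChartAt hq.1 hq' hq.2 V

theorem differentiableAt_fderiv_comp_extChartAt_symm_apply {g : M → G} {p : M}
    (hg : ContMDiffAt I 𝓘(ℝ, G) ∞ g p)
    {V : Π x : M, TangentSpace I x} (hV : MDiffAt (T% V) p) :
    DifferentiableAt ℝ (fun y ↦ fderiv ℝ (g ∘ (extChartAt I p).symm) y
        (mpullbackWithin 𝓘(ℝ, E) I (extChartAt I p).symm V (Set.range I) y))
      (extChartAt I p p) :=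
  ((contDiffAt_comp_extChartAt_symm hg).fderiv_right (m := 1) (by norm_cast)).differentiableAt
    (by simp) |>.clm_apply (differentiableAt_mpullbackWithin_extChartAt_symm hV)

theorem mdifferentiableAt_mvfderiv_apply {g : M → G} {p : M}
    (hg : ContMDiffAt I 𝓘(ℝ, G) ∞ g p)
    {V : Π x : M, TangentSpace I x} (hV : MDiffAt (T% V) p) :
    MDiffAt (fun q ↦ mvfderiv I g q (V q)) p := by
  refine MDifferentiableAt.congr_of_eventuallyEq ?_ (mvfderiv_apply_eventuallyEq hg V)
  exact (differentiableAt_fderiv_comp_extChartAt_symm_apply hg hV).mdifferentiableAt.comp p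
    (mdifferentiableAt_extChartAt (mem_chart_source H p))

/-- A Lie bracket differentiates functions as the commutator of the two fields. -/
theorem mvfderiv_apply_mlieBracket {g : M → G} {p : M} (hg : ContMDiffAt I 𝓘(ℝ, G) ∞ g p)
    {V W : Π x : M, TangentSpace I x} (hV : MDiffAt (T% V) p) (hW : MDiffAt (T% W) p) :
    mvfderiv I g p (mlieBracket I V W p) =
      mvfderiv I (fun q ↦ mvfderiv I g q (W q)) p (V p)
        - mvfderiv I (fun q ↦ mvfderiv I g q (V q)) p (W p) := by
  have hp : p ∈ (extChartAt I p).source := mem_extChartAt_source p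
  rw [mvfderiv_of_eventuallyEq_comp_extChartAt hp
      (differentiableAt_fderiv_comp_extChartAt_symm_apply hg hW) (mvfderiv_apply_eventuallyEq hg W),
    mvfderiv_of_eventuallyEq_comp_extChartAt hp
      (differentiableAt_fderiv_comp_extChartAt_symm_apply hg hV) (mvfderiv_apply_eventuallyEq hg V)]
  have hbr := fderiv_apply_lieBracket (n := 2)
    ((contDiffAt_comp_extChartAt_symm hg).of_le (by norm_cast)) (by simp)
    (differentiableAt_mpullbackWithin_extChartAt_symm hW)
    (differentiableAt_mpullbackWithin_extChartAt_symm hV)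
  refine Eq.trans ?_ hbr
  rw [mvfderiv_of_eventuallyEq_comp_extChartAt hp
    (eventually_differentiableAt_comp_extChartAt_symm hg).self_of_nhds
    (eventually_eq_comp_extChartAt g p).self_of_nhds.2]
  congr 1
  have h1 : (mlieBracket I V W p : E) = lieBracket ℝ
      (mpullbackWithin 𝓘(ℝ, E) I (extChartAt I p).symm V (Set.range I))
      (mpullbackWithin 𝓘(ℝ, E) I (extChartAt I p).symm W (Set.range I)) (extChartAt I p p) := by
    rw [← mlieBracketWithin_univ, mlieBracketWithin_apply, mfderiv_extChartAt_self,
      Set.preimage_univ, Set.univ_inter, I.range_eq_univ]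
    exact (DFunLike.congr_fun (ContinuousLinearMap.inverse_id (R := ℝ) (M := E)) _).trans
      (congrFun lieBracketWithin_univ _)
  have h2 : ∀ y, y = p → (mlieBracket I V W y : E) = (mlieBracket I V W p : E) := by
    rintro y rfl
    rfl
  rw [← h1, ← h2 _ (extChartAt_to_inv (I := I) p)]
  exact mfderivWithin_extChartAt_symm_inverse_apply (I := I) (x := p) _

variable {E' : Type*} [NormedAddCommGroup E'] [NormedSpace ℝ E'] [CompleteSpace E']
  {H' : Type*} [TopologicalSpace H'] {J : ModelWithCorners ℝ E' H'} [J.Boundaryless]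
  {N : Type*} [TopologicalSpace N] [ChartedSpace H' N] [IsManifold J ∞ N]

/-- The Lie brackets of `F`-related vector fields are `F`-related. -/
theorem mfderiv_mlieBracket_of_related {F : M → N} {p : M} (hF : ContMDiffAt I J ∞ F p)
    {V W : Π x : M, TangentSpace I x} {V' W' : Π y : N, TangentSpace J y}
    (hV : MDiffAt (T% V) p) (hW : MDiffAt (T% W) p)
    (hV' : MDiffAt (T% V') (F p)) (hW' : MDiffAt (T% W') (F p))
    (hVV' : ∀ᶠ q in 𝓝 p, mfderiv I J F q (V q) = V' (F q))
    (hWW' : ∀ᶠ q in 𝓝 p, mfderiv I J F q (W q) = W' (F q)) :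
    mfderiv I J F p (mlieBracket I V W p) = mlieBracket J V' W' (F p) := by
  set ψ := extChartAt J (F p) with hψ
  have hψs : ContMDiffAt J 𝓘(ℝ, E') ∞ ψ (F p) := contMDiffAt_extChartAt
  have hψd : ∀ᶠ q in 𝓝 p, MDiffAt ψ (F q) := by
    filter_upwards [hF.continuousAt.eventually
      (chart_source_mem_nhds H' (F p))] with q hq
    exact mdifferentiableAt_extChartAt hq
  have hFd : ∀ᶠ q in 𝓝 p, MDiffAt F q := by
    filter_upwards [(contMDiffAt_iff_contMDiffAt_nhds (by simp)).1 (hF.of_le (m := 1) (by simp))]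
      with q hq
    exact hq.mdifferentiableAt (by simp)
  have hcomp : ∀ {V : Π x : M, TangentSpace I x} {V' : Π y : N, TangentSpace J y},
      (∀ᶠ q in 𝓝 p, mfderiv I J F q (V q) = V' (F q)) →
      (fun q ↦ mvfderiv I (ψ ∘ F) q (V q)) =ᶠ[𝓝 p] (fun y ↦ mvfderiv J ψ y (V' y)) ∘ F := by
    intro V V' h
    filter_upwards [h, hψd, hFd] with q hq h1 h2
    have := mfderiv_comp_apply q h1 h2 (V q)
    rw [hq] at this
    exact this
  have hFp := hFd.self_of_nhds
  have key : ∀ {V W : Π x : M, TangentSpace I x} {V' W' : Π y : N, TangentSpace J y},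
      MDiffAt (T% V') (F p) →
      (∀ᶠ q in 𝓝 p, mfderiv I J F q (V q) = V' (F q)) →
      (∀ᶠ q in 𝓝 p, mfderiv I J F q (W q) = W' (F q)) →
      mvfderiv I (fun q ↦ mvfderiv I (ψ ∘ F) q (V q)) p (W p) =
        mvfderiv J (fun y ↦ mvfderiv J ψ y (V' y)) (F p) (W' (F p)) := by
    intro V W V' W' hV' hVV' hWW'
    have hd : MDiffAt (fun y ↦ mvfderiv J ψ y (V' y)) (F p) :=
      mdifferentiableAt_mvfderiv_apply hψs hV'
    have h1 : mfderiv I 𝓘(ℝ, E') (fun q ↦ mvfderiv I (ψ ∘ F) q (V q)) p (W p) =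
        mfderiv I 𝓘(ℝ, E') ((fun y ↦ mvfderiv J ψ y (V' y)) ∘ F) p (W p) := by
      rw [(hcomp hVV').mfderiv_eq]
      rfl
    have h2 := mfderiv_comp_apply p hd hFp (W p)
    rw [hWW'.self_of_nhds] at h2
    exact h1.trans h2
  have h1 := mvfderiv_apply_mlieBracket (hψs.comp p hF) hV hW
  have h2 := mvfderiv_apply_mlieBracket hψs hV' hW'
  rw [key hV' hVV' hWW', key hW' hWW' hVV', ← h2] at h1
  have h3 := mfderiv_comp_apply p hψd.self_of_nhds hFp (mlieBracket I V W p)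
  have hi := isInvertible_mfderiv_extChartAt (I := J) (mem_extChartAt_source (F p))
  exact hi.injective (h3.symm.trans h1)

end LieBracket

theorem eq_sum_gramSchmidt_smul {V : Type*} [NormedAddCommGroup V] [InnerProductSpace ℝ V]
    {ι : Type*} [Fintype ι] [LinearOrder ι] [LocallyFiniteOrderBot ι] [WellFoundedLT ι]
    (b : Module.Basis ι ℝ V) (v : V) :
    v = ∑ i, ((inner ℝ (InnerProductSpace.gramSchmidt ℝ b i) v : ℝ) /
      inner ℝ (InnerProductSpace.gramSchmidt ℝ b i) (InnerProductSpace.gramSchmidt ℝ b i)) •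
        InnerProductSpace.gramSchmidt ℝ b i := by
  refine InnerProductSpace.ext_inner_left_basis (InnerProductSpace.gramSchmidtBasis b) fun j ↦ ?_
  rw [InnerProductSpace.coe_gramSchmidtBasis, inner_sum, Finset.sum_eq_single j]
  · rw [inner_smul_right, div_mul_cancel₀]
    exact inner_self_ne_zero.2 (InnerProductSpace.gramSchmidt_ne_zero j b.linearIndependent)
  · intro i _ hij
    rw [inner_smul_right, InnerProductSpace.gramSchmidt_orthogonal ℝ b hij.symm, mul_zero]
  · simp

section SmoothFields

variable {E : Type*} [NormedAddCommGroup E] [NormedSpace ℝ E] [FiniteDimensional ℝ E]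
  {H : Type*} [TopologicalSpace H] {I : ModelWithCorners ℝ E H}
  {M : Type*} [TopologicalSpace M] [ChartedSpace H M] [IsManifold I ∞ M]

/-- A vector at a point extends to a global smooth vector field. -/
theorem exists_isSmoothField_eq [T2Space M] {p : M} (v : TangentSpace I p) :
    ∃ X : Π x : M, TangentSpace I x, IsSmoothField I X ∧ X p = v := by
  obtain ⟨s, hs, hsmooth⟩ := FiberBundle.exists_contMDiffOn_extend (k := ∞) I E v
  obtain ⟨f, hf⟩ := (SmoothBumpFunction.nhds_basis_support (I := I)
    (interior_mem_nhds.2 hs)).ex_mem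
  refine ⟨(f : M → ℝ) • FiberBundle.extend E v, ?_, ?_⟩
  · exact ContMDiffOn.smul_section_of_tsupport f.contMDiff.contMDiffOn isOpen_interior hf
      (hsmooth.mono interior_subset)
  · simp

variable [RiemannianBundle (fun x : M ↦ TangentSpace I x)]
  [IsContMDiffRiemannianBundle I ∞ E (fun x : M ↦ TangentSpace I x)]

theorem contMDiffAt_inner {X Y : Π x : M, TangentSpace I x} {x : M}
    (hX : CMDiffAt ∞ (T% X) x) (hY : CMDiffAt ∞ (T% Y) x) :
    CMDiffAt ∞ (fun y ↦ (inner ℝ (X y) (Y y) : ℝ)) x :=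
  ContMDiffAt.inner_bundle (IB := I) (F := E) (E := fun x : M ↦ TangentSpace I x) hX hY

/-- Smooth vector fields that are linearly independent at a point remain smooth at this point after
Gram-Schmidt orthogonalization. -/
theorem contMDiffAt_gramSchmidt {ι : Type*} [LinearOrder ι] [LocallyFiniteOrderBot ι]
    [WellFoundedLT ι] {s : ι → Π x : M, TangentSpace I x} {p : M}
    (hs : ∀ i, CMDiffAt ∞ (T% (s i)) p) (hli : LinearIndependent ℝ fun i ↦ s i p) (i : ι) :
    CMDiffAt ∞ (T% (fun x ↦ InnerProductSpace.gramSchmidt ℝ (fun i ↦ s i x) i)) p := by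
  induction i using WellFoundedLT.induction with
  | ind i ih =>
    have h (x : M) : InnerProductSpace.gramSchmidt ℝ (fun i ↦ s i x) i =
        s i x - ∑ j ∈ Finset.Iio i,
          ((inner ℝ (InnerProductSpace.gramSchmidt ℝ (fun i ↦ s i x) j) (s i x) : ℝ) /
            inner ℝ (InnerProductSpace.gramSchmidt ℝ (fun i ↦ s i x) j)
              (InnerProductSpace.gramSchmidt ℝ (fun i ↦ s i x) j)) •
            InnerProductSpace.gramSchmidt ℝ (fun i ↦ s i x) j := by
      rw [InnerProductSpace.gramSchmidt_def]
      simp only [Submodule.starProjection_singleton, real_inner_self_eq_norm_sq]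
      rfl
    refine ContMDiffAt.congr_of_eventuallyEq ?_
      (Filter.Eventually.of_forall fun x ↦ congrArg (TotalSpace.mk x) (h x))
    refine (hs i).sub_section (ContMDiffAt.sum_section fun j hj ↦ ?_)
    have hj' := ih j (Finset.mem_Iio.1 hj)
    refine ContMDiffAt.smul_section (ContMDiffAt.div₀ (contMDiffAt_inner hj' (hs i))
      (contMDiffAt_inner hj' hj') ?_) hj'
    exact inner_self_ne_zero.2 (InnerProductSpace.gramSchmidt_ne_zero j hli)

/-- A vector field is smooth at a point as soon as its inner products with the vector fields that
are smooth at this point are. -/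
theorem contMDiffAt_of_inner {Y : Π x : M, TangentSpace I x} {p : M}
    (h : ∀ Z : Π x : M, TangentSpace I x, CMDiffAt ∞ (T% Z) p →
      CMDiffAt ∞ (fun x ↦ (inner ℝ (Z x) (Y x) : ℝ)) p) :
    CMDiffAt ∞ (T% Y) p := by
  let e := trivializationAt E (TangentSpace I : M → Type _) p
  let b := Module.finBasis ℝ E
  have hp : p ∈ e.baseSet := FiberBundle.mem_baseSet_trivializationAt' p
  let s := e.localFrame b
  have hs := e.isLocalFrameOn_localFrame_baseSet I ∞ b
  let g : Fin (Module.finrank ℝ E) → Π x : M, TangentSpace I x := fun i x ↦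
    InnerProductSpace.gramSchmidt ℝ (fun i ↦ s i x) i
  have hg : ∀ i, CMDiffAt ∞ (T% (g i)) p := fun i ↦
    contMDiffAt_gramSchmidt (fun i ↦ hs.contMDiffAt e.open_baseSet hp i)
      (hs.linearIndependent hp) i
  have hsum : ∀ᶠ x in 𝓝 p, Y x = ∑ i, ((inner ℝ (g i x) (Y x) : ℝ) /
      inner ℝ (g i x) (g i x)) • g i x := by
    filter_upwards [e.open_baseSet.mem_nhds hp] with x hx
    have := eq_sum_gramSchmidt_smul (hs.toBasisAt hx) (Y x)
    rwa [show ⇑(hs.toBasisAt hx) = fun i ↦ s i x from funext fun i ↦ hs.toBasisAt_coe hx i] at this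
  refine ContMDiffAt.congr_of_eventuallyEq (f := T% fun x ↦ ∑ i, ((inner ℝ (g i x) (Y x) : ℝ) /
      inner ℝ (g i x) (g i x)) • g i x) ?_ ?_
  · refine ContMDiffAt.sum_section fun i _ ↦ ContMDiffAt.smul_section
      (ContMDiffAt.div₀ (h _ (hg i)) (contMDiffAt_inner (hg i) (hg i)) ?_) (hg i)
    exact inner_self_ne_zero.2 (InnerProductSpace.gramSchmidt_ne_zero i (hs.linearIndependent hp))
  · filter_upwards [hsum] with x hx
    rw [← hx]

end SmoothFields

section HorizontalLift

variable {E : Type*} [NormedAddCommGroup E] [NormedSpace ℝ E] [FiniteDimensional ℝ E]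
  {H : Type*} [TopologicalSpace H] {I : ModelWithCorners ℝ E H}
  {M : Type*} [TopologicalSpace M] [ChartedSpace H M] [IsManifold I ∞ M]
  {E' : Type*} [NormedAddCommGroup E'] [NormedSpace ℝ E'] [FiniteDimensional ℝ E']
  {H' : Type*} [TopologicalSpace H'] {J : ModelWithCorners ℝ E' H'}
  {N : Type*} [TopologicalSpace N] [ChartedSpace H' N] [IsManifold J ∞ N]
  {F : M → N}

theorem mem_verticalSpace {x : M} {v : TangentSpace I x} :
    v ∈ verticalSpace I J F x ↔ mfderiv I J F x v = 0 :=
  Iff.rfl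

theorem contMDiffAt_mfderiv_apply (hF : ContMDiff I J ∞ F) {X : Π x : M, TangentSpace I x} {p : M}
    (hX : CMDiffAt ∞ (T% X) p) :
    ContMDiffAt I J.tangent ∞ (fun q ↦ (⟨F q, mfderiv I J F q (X q)⟩ : TangentBundle J N)) p :=
  (hF.contMDiff_tangentMap (m := ∞) (by simp)).contMDiffAt.comp p hX

theorem mdifferentiableAt_mfderiv_apply (hF : ContMDiff I J ∞ F) {X : Π x : M, TangentSpace I x}
    {p : M} (hX : MDiffAt (T% X) p) :
    MDifferentiableAt I J.tangent
      (fun q ↦ (⟨F q, mfderiv I J F q (X q)⟩ : TangentBundle J N)) p :=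
  ((hF.contMDiff_tangentMap (m := ∞) (by simp)).mdifferentiableAt (by simp)).comp p hX

variable [RiemannianBundle (fun x : M ↦ TangentSpace I x)]
  [RiemannianBundle (fun y : N ↦ TangentSpace J y)]

variable (I J F) in
/-- The adjoint of the differential of `F`. For a Riemannian submersion, it is the horizontal
lift. -/
def horizontalLift (x : M) : TangentSpace J (F x) →ₗ[ℝ] TangentSpace I x :=
  LinearMap.adjoint (mfderiv I J F x : TangentSpace I x →ₗ[ℝ] TangentSpace J (F x))

theorem inner_horizontalLift_left {x : M} (w : TangentSpace J (F x)) (v : TangentSpace I x) :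
    inner ℝ (horizontalLift I J F x w) v = inner ℝ w (mfderiv I J F x v) :=
  LinearMap.adjoint_inner_left _ _ _

theorem inner_horizontalLift_right {x : M} (w : TangentSpace J (F x)) (v : TangentSpace I x) :
    inner ℝ v (horizontalLift I J F x w) = inner ℝ (mfderiv I J F x v) w :=
  LinearMap.adjoint_inner_right _ _ _

theorem mfderiv_starProjection_horizontalSpace {x : M} (v : TangentSpace I x) :
    mfderiv I J F x ((horizontalSpace I J F x).starProjection v) = mfderiv I J F x v := by
  have h : v - (horizontalSpace I J F x).starProjection v ∈ verticalSpace I J F x := by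
    have : v - (horizontalSpace I J F x).starProjection v ∈ (verticalSpace I J F x)ᗮᗮ :=
      Submodule.sub_starProjection_mem_orthogonal (K := horizontalSpace I J F x) v
    rwa [Submodule.orthogonal_orthogonal] at this
  have h' := mem_verticalSpace.1 h
  rw [map_sub, sub_eq_zero] at h'
  exact h'.symm

namespace IsRiemannianSubmersion

theorem inner_mfderiv (hF : IsRiemannianSubmersion I J F)
    {x : M} {v w : TangentSpace I x} (hv : v ∈ horizontalSpace I J F x)
    (hw : w ∈ horizontalSpace I J F x) :
    inner ℝ (mfderiv I J F x v) (mfderiv I J F x w) = inner ℝ v w := by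
  rw [real_inner_eq_norm_mul_self_add_norm_mul_self_sub_norm_sub_mul_self_div_two,
    real_inner_eq_norm_mul_self_add_norm_mul_self_sub_norm_sub_mul_self_div_two,
    ← map_sub, hF.norm_mfderiv x _ hv, hF.norm_mfderiv x _ hw,
    hF.norm_mfderiv x _ (Submodule.sub_mem _ hv hw)]

theorem horizontalLift_mfderiv (hF : IsRiemannianSubmersion I J F) {x : M} (v : TangentSpace I x) :
    horizontalLift I J F x (mfderiv I J F x v) = (horizontalSpace I J F x).starProjection v := by
  refine ext_inner_right ℝ fun u ↦ ?_
  rw [inner_horizontalLift_left, ← mfderiv_starProjection_horizontalSpace v,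
    ← mfderiv_starProjection_horizontalSpace u,
    hF.inner_mfderiv (Submodule.starProjection_apply_mem _ _)
      (Submodule.starProjection_apply_mem _ _), ← Submodule.inner_starProjection_left_eq_right,
    Submodule.starProjection_eq_self_iff.2 (Submodule.starProjection_apply_mem _ _)]

theorem mfderiv_horizontalLift (hF : IsRiemannianSubmersion I J F)
    {x : M} (w : TangentSpace J (F x)) :
    mfderiv I J F x (horizontalLift I J F x w) = w := by
  obtain ⟨v, rfl⟩ := hF.surjective_mfderiv x w
  rw [hF.horizontalLift_mfderiv, mfderiv_starProjection_horizontalSpace]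

theorem inner_horizontalLift_horizontalLift (hF : IsRiemannianSubmersion I J F)
    {x : M} (w w' : TangentSpace J (F x)) :
    inner ℝ (horizontalLift I J F x w) (horizontalLift I J F x w') = inner ℝ w w' := by
  rw [inner_horizontalLift_left, hF.mfderiv_horizontalLift]

variable [IsContMDiffRiemannianBundle I ∞ E (fun x : M ↦ TangentSpace I x)]
  [IsContMDiffRiemannianBundle J ∞ E' (fun y : N ↦ TangentSpace J y)]

theorem contMDiffAt_horizontalLift (hF : IsRiemannianSubmersion I J F)
    {s : Π q : M, TangentSpace J (F q)} {p : M}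
    (hs : ContMDiffAt I J.tangent ∞ (fun q ↦ (⟨F q, s q⟩ : TangentBundle J N)) p) :
    CMDiffAt ∞ (T% (fun q ↦ horizontalLift I J F q (s q))) p := by
  refine contMDiffAt_of_inner fun Z hZ ↦ ?_
  simp only [inner_horizontalLift_right]
  exact ContMDiffAt.inner_bundle (IB := J) (F := E') (E := fun y : N ↦ TangentSpace J y)
    (contMDiffAt_mfderiv_apply hF.contMDiff hZ) hs

theorem isHorizontalField_horizontalPart (hF : IsRiemannianSubmersion I J F)
    {X : Π x : M, TangentSpace I x} (hX : IsSmoothField I X) :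
    IsHorizontalField I J F (horizontalPart I J F X) where
  smooth p := by
    have := hF.contMDiffAt_horizontalLift (contMDiffAt_mfderiv_apply hF.contMDiff (hX p))
    simp only [hF.horizontalLift_mfderiv] at this
    exact this
  mem _ := Submodule.starProjection_apply_mem _ _

theorem isVerticalField_verticalPart (hF : IsRiemannianSubmersion I J F)
    {X : Π x : M, TangentSpace I x} (hX : IsSmoothField I X) :
    IsVerticalField I J F (verticalPart I J F X) where
  smooth := by
    have h : verticalPart I J F X = X - horizontalPart I J F X := by
      funext x
      exact eq_sub_of_add_eq (Submodule.starProjection_add_starProjection_orthogonal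
        (K := verticalSpace I J F x) (X x))
    rw [h]
    exact ContMDiff.sub_section hX (hF.isHorizontalField_horizontalPart hX).smooth
  mem _ := Submodule.starProjection_apply_mem _ _

theorem exists_isVerticalField_eq [T2Space M] (hF : IsRiemannianSubmersion I J F)
    {p : M} {v : TangentSpace I p}
    (hv : v ∈ verticalSpace I J F p) :
    ∃ V : Π x : M, TangentSpace I x, IsVerticalField I J F V ∧ V p = v := by
  obtain ⟨X, hX, hXp⟩ := exists_isSmoothField_eq v
  refine ⟨_, hF.isVerticalField_verticalPart hX, ?_⟩
  rw [verticalPart, hXp]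
  exact Submodule.starProjection_eq_self_iff.2 hv

theorem exists_isHorizontalField_eq [T2Space M] (hF : IsRiemannianSubmersion I J F)
    {p : M} {v : TangentSpace I p}
    (hv : v ∈ horizontalSpace I J F p) :
    ∃ X : Π x : M, TangentSpace I x, IsHorizontalField I J F X ∧ X p = v := by
  obtain ⟨X, hX, hXp⟩ := exists_isSmoothField_eq v
  refine ⟨_, hF.isHorizontalField_horizontalPart hX, ?_⟩
  rw [horizontalPart, hXp]
  exact Submodule.starProjection_eq_self_iff.2 hv

end IsRiemannianSubmersion
end HorizontalLift

section PullbackConnection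

variable {E : Type*} [NormedAddCommGroup E] [NormedSpace ℝ E]
  {H : Type*} [TopologicalSpace H] {I : ModelWithCorners ℝ E H}
  {M : Type*} [TopologicalSpace M] [ChartedSpace H M]
  {E' : Type*} [NormedAddCommGroup E'] [NormedSpace ℝ E'] [FiniteDimensional ℝ E']
  {H' : Type*} [TopologicalSpace H'] {J : ModelWithCorners ℝ E' H'}
  {N : Type*} [TopologicalSpace N] [ChartedSpace H' N] [IsManifold J ∞ N]
  {F : M → N}

theorem extend_add {y : N} (u w : TangentSpace J y) :
    ∀ᶠ z in 𝓝 y, (FiberBundle.extend E' (u + w) : Π y : N, TangentSpace J y) z =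
      (FiberBundle.extend E' u + FiberBundle.extend E' w : Π y : N, TangentSpace J y) z := by
  let e := trivializationAt E' (TangentSpace J : N → Type _) y
  have hy : y ∈ e.baseSet := FiberBundle.mem_baseSet_trivializationAt' y
  have h : (e ⟨y, u + w⟩).2 = (e ⟨y, u⟩).2 + (e ⟨y, w⟩).2 := (e.linear ℝ hy).map_add u w
  filter_upwards [e.open_baseSet.mem_nhds hy] with z hz
  change e.symm z (e ⟨y, u + w⟩).2 = e.symm z (e ⟨y, u⟩).2 + e.symm z (e ⟨y, w⟩).2
  rw [h, ← e.coe_symmₗ (R := ℝ) hz, map_add]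

theorem extend_smul {y : N} (a : ℝ) (u : TangentSpace J y) :
    ∀ᶠ z in 𝓝 y, (FiberBundle.extend E' (a • u) : Π y : N, TangentSpace J y) z =
      (a • FiberBundle.extend E' u : Π y : N, TangentSpace J y) z := by
  let e := trivializationAt E' (TangentSpace J : N → Type _) y
  have hy : y ∈ e.baseSet := FiberBundle.mem_baseSet_trivializationAt' y
  have h : (e ⟨y, a • u⟩).2 = a • (e ⟨y, u⟩).2 := (e.linear ℝ hy).map_smul a u
  filter_upwards [e.open_baseSet.mem_nhds hy] with z hz
  change e.symm z (e ⟨y, a • u⟩).2 = a • e.symm z (e ⟨y, u⟩).2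
  rw [h, ← e.coe_symmₗ (R := ℝ) hz, map_smul]

/-- The coordinates, in the trivialization of `TN` at `F p`, of a differentiable vector field
along `F` are differentiable. -/
theorem mdifferentiableAt_coord {s : Π q : M, TangentSpace J (F q)} {p : M}
    (hs : MDifferentiableAt I J.tangent (fun q ↦ (⟨F q, s q⟩ : TangentBundle J N)) p) :
    MDiffAt (fun q ↦ (trivializationAt E' (TangentSpace J : N → Type _) (F p)
      (⟨F q, s q⟩ : TotalSpace E' (TangentSpace J : N → Type _))).2) p :=
  (mdifferentiableAt_totalSpace J _).1 hs |>.2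

variable [RiemannianBundle (fun y : N ↦ TangentSpace J y)]
  [IsContMDiffRiemannianBundle J ∞ E' (fun y : N ↦ TangentSpace J y)]

theorem covariantDerivative_extend_add (D : CovariantDerivative J E' (TangentSpace J : N → Type _))
    {y : N} (u w : TangentSpace J y) :
    D (FiberBundle.extend E' (u + w)) y =
      D (FiberBundle.extend E' u) y + D (FiberBundle.extend E' w) y := by
  have hu := FiberBundle.mdifferentiableAt_extend J E' u
  have hw := FiberBundle.mdifferentiableAt_extend J E' w
  rw [← D.isCovariantDerivativeOnUniv.add hu hw]
  exact D.isCovariantDerivativeOnUniv.congr_of_eventuallyEq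
    (FiberBundle.mdifferentiableAt_extend J E' _) (mdifferentiableAt_add_section hu hw)
    Filter.univ_mem (extend_add u w)

theorem covariantDerivative_extend_smul (D : CovariantDerivative J E' (TangentSpace J : N → Type _))
    {y : N} (a : ℝ) (u : TangentSpace J y) :
    D (FiberBundle.extend E' (a • u)) y = a • D (FiberBundle.extend E' u) y := by
  have hu := FiberBundle.mdifferentiableAt_extend J E' u
  rw [← D.isCovariantDerivativeOnUniv.smul_const a hu]
  exact D.isCovariantDerivativeOnUniv.congr_of_eventuallyEq
    (FiberBundle.mdifferentiableAt_extend J E' _) (mdifferentiableAt_const.smul_section hu)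
    Filter.univ_mem (extend_smul a u)

theorem pullbackNabla_add [CompleteSpace E'] {s t : Π q : M, TangentSpace J (F q)} {p : M}
    (hF : ContinuousAt F p)
    (hs : MDifferentiableAt I J.tangent (fun q ↦ (⟨F q, s q⟩ : TangentBundle J N)) p)
    (ht : MDifferentiableAt I J.tangent (fun q ↦ (⟨F q, t q⟩ : TangentBundle J N)) p)
    (v : TangentSpace I p) :
    pullbackNabla I J F (fun q ↦ s q + t q) p v =
      pullbackNabla I J F s p v + pullbackNabla I J F t p v := by
  let e := trivializationAt E' (TangentSpace J : N → Type _) (F p)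
  have hmem : F p ∈ e.baseSet := FiberBundle.mem_baseSet_trivializationAt' (F p)
  let c : (Π q : M, TangentSpace J (F q)) → M → E' := fun s q ↦
    (e (⟨F q, s q⟩ : TotalSpace E' (TangentSpace J : N → Type _))).2
  have h1 : c (fun q ↦ s q + t q) =ᶠ[𝓝 p] c s + c t := by
    filter_upwards [hF.eventually (e.open_baseSet.mem_nhds hmem)] with q hq
    exact (e.linear ℝ hq).map_add (s q) (t q)
  have h2 : mvfderiv I (c (fun q ↦ s q + t q)) p = mvfderiv I (c s + c t) p := by
    ext u
    simp only [mvfderiv, h1.mfderiv_eq, ContinuousLinearMap.comp_apply]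
    rfl
  change e.symmL ℝ (F p) (mvfderiv I (c (fun q ↦ s q + t q)) p v) + _ =
    (e.symmL ℝ (F p) (mvfderiv I (c s) p v) + _) + (e.symmL ℝ (F p) (mvfderiv I (c t) p v) + _)
  rw [h2, mvfderiv_add (mdifferentiableAt_coord hs) (mdifferentiableAt_coord ht),
    covariantDerivative_extend_add]
  simp only [add_apply, map_add]
  abel

theorem pullbackNabla_smul [CompleteSpace E'] {f : M → ℝ} {s : Π q : M, TangentSpace J (F q)}
    {p : M} (hF : ContinuousAt F p) (hf : MDiffAt f p)
    (hs : MDifferentiableAt I J.tangent (fun q ↦ (⟨F q, s q⟩ : TangentBundle J N)) p)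
    (v : TangentSpace I p) :
    pullbackNabla I J F (fun q ↦ f q • s q) p v =
      f p • pullbackNabla I J F s p v + mvfderiv I f p v • s p := by
  let e := trivializationAt E' (TangentSpace J : N → Type _) (F p)
  have hmem : F p ∈ e.baseSet := FiberBundle.mem_baseSet_trivializationAt' (F p)
  let c : (Π q : M, TangentSpace J (F q)) → M → E' := fun s q ↦
    (e (⟨F q, s q⟩ : TotalSpace E' (TangentSpace J : N → Type _))).2
  have h1 : c (fun q ↦ f q • s q) =ᶠ[𝓝 p] f • c s := by
    filter_upwards [hF.eventually (e.open_baseSet.mem_nhds hmem)] with q hq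
    exact (e.linear ℝ hq).map_smul (f q) (s q)
  have h2 : mvfderiv I (c (fun q ↦ f q • s q)) p = mvfderiv I (f • c s) p := by
    ext u
    simp only [mvfderiv, h1.mfderiv_eq, ContinuousLinearMap.comp_apply]
    rfl
  have h3 : e.symmL ℝ (F p) (c s p) = s p := by
    rw [e.symmL_apply hmem]
    exact e.symm_apply_apply_mk hmem (s p)
  change e.symmL ℝ (F p) (mvfderiv I (c (fun q ↦ f q • s q)) p v) + _ =
    f p • (e.symmL ℝ (F p) (mvfderiv I (c s) p v) + _) + _
  have h4 : mvfderiv I (f • c s) p v = f p • mvfderiv I (c s) p v + mvfderiv I f p v • c s p := by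
    have hcs : MDiffAt (c s) p := mdifferentiableAt_coord hs
    rw [mvfderiv_smul hf hcs]
    rfl
  rw [h2, h4, covariantDerivative_extend_smul, smul_apply, map_add, map_smul, map_smul, h3]
  rw [smul_add]
  abel

end PullbackConnection

section SecondFundamentalForm

variable {E : Type*} [NormedAddCommGroup E] [NormedSpace ℝ E] [FiniteDimensional ℝ E]
  [CompleteSpace E]
  {H : Type*} [TopologicalSpace H] {I : ModelWithCorners ℝ E H}
  {M : Type*} [TopologicalSpace M] [ChartedSpace H M] [IsManifold I ∞ M]
  {E' : Type*} [NormedAddCommGroup E'] [NormedSpace ℝ E'] [FiniteDimensional ℝ E']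
  [CompleteSpace E']
  {H' : Type*} [TopologicalSpace H'] {J : ModelWithCorners ℝ E' H'}
  {N : Type*} [TopologicalSpace N] [ChartedSpace H' N] [IsManifold J ∞ N]
  [RiemannianBundle (fun x : M ↦ TangentSpace I x)]
  [IsContMDiffRiemannianBundle I ∞ E (fun x : M ↦ TangentSpace I x)]
  [RiemannianBundle (fun y : N ↦ TangentSpace J y)]
  [IsContMDiffRiemannianBundle J ∞ E' (fun y : N ↦ TangentSpace J y)]
  {F : M → N}

theorem tensorialAt_secondFundamentalForm (hF : ContMDiff I J ∞ F) {p : M} (v : TangentSpace I p) :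
    TensorialAt I E (fun Y : Π x : M, TangentSpace I x ↦
      pullbackNabla I J F (fun q ↦ mfderiv I J F q (Y q)) p v
        - mfderiv I J F p (leviCivita I Y p v)) p where
  smul {f Y} hf hY := by
    have h := pullbackNabla_smul hF.continuous.continuousAt hf
      (mdifferentiableAt_mfderiv_apply hF hY) v
    simp only [Pi.smul_apply', map_smul, h,
      (leviCivita I).isCovariantDerivativeOnUniv.leibniz hY hf]
    simp [smul_sub]
  add {Y Y'} hY hY' := by
    have h := pullbackNabla_add hF.continuous.continuousAt
      (mdifferentiableAt_mfderiv_apply hF hY) (mdifferentiableAt_mfderiv_apply hF hY') v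
    simp only [Pi.add_apply, map_add, h,
      (leviCivita I).isCovariantDerivativeOnUniv.add hY hY', add_apply]
    abel

namespace IsRiemannianSubmersion

theorem secondFundamentalForm_of_isVerticalField (hF : IsRiemannianSubmersion I J F)
    {V : Π x : M, TangentSpace I x} (hV : IsVerticalField I J F V) (X : Π x : M, TangentSpace I x)
    (p : M) :
    secondFundamentalForm I J F X V p = - mfderiv I J F p (nabla I X V p) := by
  have h : (fun q ↦ mfderiv I J F q (V q)) = fun q ↦ (0 : Π y : N, TangentSpace J y) (F q) :=
    funext fun q ↦ hV.mem q
  rw [secondFundamentalForm, h, pullbackNabla_comp I J F (Y := 0)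
    (hF.contMDiff.mdifferentiableAt (by simp)) (mdifferentiable_zeroSection ℝ _ _)]
  simp

variable [I.Boundaryless] [J.Boundaryless]

/-- The Koszul expressions of vector fields on the base and of their horizontal lifts agree. -/
theorem koszul_horizontalLift (hF : IsRiemannianSubmersion I J F)
    {X Y Z : Π y : N, TangentSpace J y} {p : M} (hX : CMDiffAt ∞ (T% X) (F p))
    (hY : CMDiffAt ∞ (T% Y) (F p)) (hZ : CMDiffAt ∞ (T% Z) (F p)) :
    koszul I (fun q ↦ horizontalLift I J F q (X (F q))) (fun q ↦ horizontalLift I J F q (Y (F q)))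
      (fun q ↦ horizontalLift I J F q (Z (F q))) p = koszul J X Y Z (F p) := by
  have hFp : MDiffAt F p := hF.contMDiff.mdifferentiableAt (by simp)
  have hlift : ∀ {X : Π y : N, TangentSpace J y}, CMDiffAt ∞ (T% X) (F p) →
      MDiffAt (T% (fun q ↦ horizontalLift I J F q (X (F q)))) p := fun hX ↦
    (hF.contMDiffAt_horizontalLift (hX.comp p hF.contMDiff.contMDiffAt)).mdifferentiableAt (by simp)
  have hbr : ∀ {X Y : Π y : N, TangentSpace J y} (Z : Π y : N, TangentSpace J y),
      CMDiffAt ∞ (T% X) (F p) → CMDiffAt ∞ (T% Y) (F p) →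
      (inner ℝ (VectorField.mlieBracket I (fun q ↦ horizontalLift I J F q (X (F q)))
        (fun q ↦ horizontalLift I J F q (Y (F q))) p) (horizontalLift I J F p (Z (F p))) : ℝ) =
      inner ℝ (VectorField.mlieBracket J X Y (F p)) (Z (F p)) := by
    intro X Y Z hX hY
    rw [inner_horizontalLift_right, mfderiv_mlieBracket_of_related hF.contMDiff.contMDiffAt
      (hlift hX) (hlift hY) (hX.mdifferentiableAt (by simp)) (hY.mdifferentiableAt (by simp))
      (.of_forall fun q ↦ hF.mfderiv_horizontalLift _)
      (.of_forall fun q ↦ hF.mfderiv_horizontalLift _)]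
  have hder : ∀ (X : Π y : N, TangentSpace J y) {Y Z : Π y : N, TangentSpace J y},
      CMDiffAt ∞ (T% Y) (F p) → CMDiffAt ∞ (T% Z) (F p) →
      mvfderiv I (fun q ↦ (inner ℝ (horizontalLift I J F q (Y (F q)))
        (horizontalLift I J F q (Z (F q))) : ℝ)) p (horizontalLift I J F p (X (F p))) =
      mvfderiv J (fun y ↦ (inner ℝ (Y y) (Z y) : ℝ)) (F p) (X (F p)) := by
    intro X Y Z hY hZ
    simp only [hF.inner_horizontalLift_horizontalLift]
    have h := mvfderiv_comp_apply p (mdifferentiableAt_inner J (hY.mdifferentiableAt (by simp))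
      (hZ.mdifferentiableAt (by simp))) hFp (horizontalLift I J F p (X (F p)))
    rw [hF.mfderiv_horizontalLift] at h
    exact h
  simp only [koszul]
  rw [hder X hY hZ, hder Y hZ hX, hder Z hX hY, hbr Z hX hY, hbr X hY hZ, hbr Y hZ hX]

/-- The covariant derivative of a horizontal lift in a horizontal direction projects to the
covariant derivative on the base. -/
theorem mfderiv_leviCivita_horizontalLift (hF : IsRiemannianSubmersion I J F)
    {Y : Π y : N, TangentSpace J y} {p : M} (hY : CMDiffAt ∞ (T% Y) (F p))
    {v : TangentSpace I p} (hv : v ∈ horizontalSpace I J F p) :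
    mfderiv I J F p (leviCivita I (fun q ↦ horizontalLift I J F q (Y (F q))) p v) =
      leviCivita J Y (F p) (mfderiv I J F p v) := by
  refine ext_inner_right ℝ fun w ↦ ?_
  have hext : ∀ u : TangentSpace J (F p),
      CMDiffAt ∞ (T% (FiberBundle.extend E' u : Π y : N, TangentSpace J y)) (F p) :=
    fun u ↦ FiberBundle.contMDiffAt_extend J E' u
  have hlift : ∀ {X : Π y : N, TangentSpace J y}, CMDiffAt ∞ (T% X) (F p) →
      MDiffAt (T% (fun q ↦ horizontalLift I J F q (X (F q)))) p := fun hX ↦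
    (hF.contMDiffAt_horizontalLift (hX.comp p hF.contMDiff.contMDiffAt)).mdifferentiableAt (by simp)
  set u := mfderiv I J F p v with hu
  have hvu : v = horizontalLift I J F p (FiberBundle.extend E' u (F p)) := by
    rw [FiberBundle.extend_apply_self, hu, hF.horizontalLift_mfderiv,
      Submodule.starProjection_eq_self_iff.2 hv]
  have h1 := inner_leviCivita I (hlift (hext u)) (hlift hY) (hlift (hext w))
  have h2 := inner_leviCivita J ((hext u).mdifferentiableAt (by simp))
    (hY.mdifferentiableAt (by simp)) ((hext w).mdifferentiableAt (by simp))
  rw [hF.koszul_horizontalLift (hext u) hY (hext w), ← h2, ← hvu, inner_horizontalLift_right,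
    FiberBundle.extend_apply_self, FiberBundle.extend_apply_self] at h1
  exact h1

/-- A Riemannian submersion is totally geodesic if and only if the covariant derivatives of its
vertical fields are vertical. -/
theorem isTotallyGeodesicMap_iff [T2Space M] (hF : IsRiemannianSubmersion I J F) :
    IsTotallyGeodesicMap I J F ↔ ∀ V : Π x : M, TangentSpace I x, IsVerticalField I J F V →
      ∀ (p : M) (v : TangentSpace I p), leviCivita I V p v ∈ verticalSpace I J F p := by
  constructor
  · intro h V hV p v
    obtain ⟨X, hX, rfl⟩ := exists_isSmoothField_eq v
    have := h X V hX hV.smooth p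
    rw [hF.secondFundamentalForm_of_isVerticalField hV, neg_eq_zero] at this
    exact this
  · intro h X Y hX hY p
    obtain ⟨V, hV, hVp⟩ := hF.exists_isVerticalField_eq (p := p)
      (v := (verticalSpace I J F p).starProjection (Y p)) (Submodule.starProjection_apply_mem _ _)
    let B : Π y : N, TangentSpace J y := FiberBundle.extend E' (mfderiv I J F p (Y p))
    have hB : CMDiffAt ∞ (T% B) (F p) := FiberBundle.contMDiffAt_extend J E' _
    let L : Π x : M, TangentSpace I x := fun q ↦ horizontalLift I J F q (B (F q))
    have hL : MDiffAt (T% L) p := (hF.contMDiffAt_horizontalLift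
      (hB.comp p hF.contMDiff.contMDiffAt)).mdifferentiableAt (by simp)
    have hV' : MDiffAt (T% V) p := hV.smooth.mdifferentiableAt (by simp)
    have hLp : L p = (horizontalSpace I J F p).starProjection (Y p) := by
      rw [← hF.horizontalLift_mfderiv]
      exact congrArg (horizontalLift I J F p)
        (FiberBundle.extend_apply_self E' (mfderiv I J F p (Y p)))
    have htens := tensorialAt_secondFundamentalForm hF.contMDiff (X p)
    have hsplit := htens.pointwise (hY.mdifferentiableAt (by simp))
      (mdifferentiableAt_add_section hV' hL) (by
        rw [Pi.add_apply, hVp, hLp]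
        exact (Submodule.starProjection_add_starProjection_orthogonal
          (K := verticalSpace I J F p) (Y p)).symm)
    rw [htens.add hV' hL] at hsplit
    refine hsplit.trans ?_
    have hVzero := hF.secondFundamentalForm_of_isVerticalField hV X p
    rw [nabla, mem_verticalSpace.1 (h V hV p (X p)), neg_zero] at hVzero
    refine (congrArg₂ (· + ·) hVzero ?_).trans (zero_add 0)
    have hFL : (fun q ↦ mfderiv I J F q (L q)) = fun q ↦ B (F q) :=
      funext fun q ↦ hF.mfderiv_horizontalLift _
    rw [hFL, pullbackNabla_comp I J F (hF.contMDiff.mdifferentiableAt (by simp))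
      (hB.mdifferentiableAt (by simp)), sub_eq_zero]
    have hvert : mfderiv I J F p (leviCivita I L p
        ((verticalSpace I J F p).starProjection (X p))) = 0 := by
      obtain ⟨W, hW, hWp⟩ := hF.exists_isVerticalField_eq (p := p)
        (v := (verticalSpace I J F p).starProjection (X p)) (Submodule.starProjection_apply_mem _ _)
      have hW' : MDiffAt (T% W) p := hW.smooth.mdifferentiableAt (by simp)
      have htor := (CovariantDerivative.torsion_eq_zero_iff _).1 (leviCivita_torsion I) hW' hL
      have hbr := mfderiv_mlieBracket_of_related hF.contMDiff.contMDiffAt hW' hL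
        (V' := 0) (mdifferentiable_zeroSection ℝ _ _) (hB.mdifferentiableAt (by simp))
        (.of_forall hW.mem) (.of_forall fun q ↦ hF.mfderiv_horizontalLift _)
      rw [VectorField.mlieBracket_zero_left, ← htor, map_sub,
        mem_verticalSpace.1 (h W hW p _), sub_zero, hWp] at hbr
      exact hbr
    have hhor := hF.mfderiv_leviCivita_horizontalLift hB
      (v := (horizontalSpace I J F p).starProjection (X p)) (Submodule.starProjection_apply_mem _ _)
    rw [mfderiv_starProjection_horizontalSpace] at hhor
    have hX : X p = (verticalSpace I J F p).starProjection (X p) +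
        (horizontalSpace I J F p).starProjection (X p) :=
      (Submodule.starProjection_add_starProjection_orthogonal
        (K := verticalSpace I J F p) (X p)).symm
    rw [← hhor]
    conv_rhs => rw [hX]
    rw [map_add, map_add, hvert, zero_add]

end IsRiemannianSubmersion
end SecondFundamentalForm

section ONeillTensors

variable {E : Type*} [NormedAddCommGroup E] [NormedSpace ℝ E] [FiniteDimensional ℝ E]
  [CompleteSpace E]
  {H : Type*} [TopologicalSpace H] {I : ModelWithCorners ℝ E H}
  {M : Type*} [TopologicalSpace M] [ChartedSpace H M] [IsManifold I ∞ M]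
  {E' : Type*} [NormedAddCommGroup E'] [NormedSpace ℝ E']
  {H' : Type*} [TopologicalSpace H'] {J : ModelWithCorners ℝ E' H'}
  {N : Type*} [TopologicalSpace N] [ChartedSpace H' N] [IsManifold J ∞ N]
  [RiemannianBundle (fun x : M ↦ TangentSpace I x)]
  {F : M → N}

theorem IsVerticalField.verticalPart_eq {V : Π x : M, TangentSpace I x}
    (hV : IsVerticalField I J F V) : verticalPart I J F V = V :=
  funext fun x ↦ Submodule.starProjection_eq_self_iff.2 (hV.mem x)

theorem IsHorizontalField.horizontalPart_eq {X : Π x : M, TangentSpace I x}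
    (hX : IsHorizontalField I J F X) : horizontalPart I J F X = X :=
  funext fun x ↦ Submodule.starProjection_eq_self_iff.2 (hX.mem x)

theorem IsHorizontalField.verticalPart_eq_zero {X : Π x : M, TangentSpace I x}
    (hX : IsHorizontalField I J F X) : verticalPart I J F X = 0 :=
  funext fun x ↦ (Submodule.starProjection_apply_eq_zero_iff _).2 (hX.mem x)

/-- The structure tensor `φ` of an anti-invariant submersion sends vertical fields to horizontal
fields. -/
theorem IsVerticalField.phiField [RiemannianBundle (fun y : N ↦ TangentSpace J y)]
    {S : AlmostContactMetricStructure I M} (hF : IsAntiInvariantRiemannianSubmersion I J F S)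
    {V : Π x : M, TangentSpace I x} (hV : IsVerticalField I J F V) :
    IsHorizontalField I J F (S.phiField V) where
  smooth x := ContMDiffAt.clm_bundle_apply (F₁ := E) (F₂ := E) (S.contMDiff_phi x) (hV.smooth x)
  mem x := hF.map_phi_le x _ (hV.mem x)

variable [IsContMDiffRiemannianBundle I ∞ E (fun x : M ↦ TangentSpace I x)]

theorem oneillT_apply_of_isHorizontalField {W Z : Π x : M, TangentSpace I x}
    (hW : IsVerticalField I J F W) (hZ : IsHorizontalField I J F Z) (p : M) :
    oneillT I J F W Z p = (verticalSpace I J F p).starProjection (leviCivita I Z p (W p)) := by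
  rw [oneillT, hW.verticalPart_eq, hZ.horizontalPart_eq, hZ.verticalPart_eq_zero]
  simp [verticalPart, horizontalPart, nabla]

theorem oneillA_apply_of_isHorizontalField {X Z : Π x : M, TangentSpace I x}
    (hX : IsHorizontalField I J F X) (hZ : IsHorizontalField I J F Z) (p : M) :
    oneillA I J F X Z p = (verticalSpace I J F p).starProjection (leviCivita I Z p (X p)) := by
  rw [oneillA, hX.horizontalPart_eq, hZ.horizontalPart_eq, hZ.verticalPart_eq_zero]
  simp [verticalPart, horizontalPart, nabla]

/-- The parts of `∇ V` and `∇ Z` exchanging the two distributions are opposite adjoints. -/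
theorem inner_leviCivita_eq_neg {V Z : Π x : M, TangentSpace I x}
    (hV : IsVerticalField I J F V) (hZ : IsHorizontalField I J F Z) (p : M)
    (v : TangentSpace I p) :
    inner ℝ (V p) (leviCivita I Z p v) = - inner ℝ (leviCivita I V p v) (Z p) := by
  have h := leviCivita_metric I (FiberBundle.mdifferentiableAt_extend I E v)
    (hV.smooth.mdifferentiableAt (x := p) (by simp)) (hZ.smooth.mdifferentiableAt (by simp))
  have h0 : (fun y ↦ (inner ℝ (V y) (Z y) : ℝ)) = fun _ ↦ 0 :=
    funext fun y ↦ Submodule.inner_right_of_mem_orthogonal (hV.mem y) (hZ.mem y)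
  rw [h0, mvfderiv_const, FiberBundle.extend_apply_self, zero_apply] at h
  exact eq_neg_of_add_eq_zero_right h.symm

/-- The vertical fields have vertical covariant derivatives if and only if the horizontal fields
`φ V`, for `V` vertical, have horizontal covariant derivatives, whenever `φ` maps the vertical
distribution onto the horizontal one. -/
theorem leviCivita_mem_verticalSpace_iff [T2Space M]
    [RiemannianBundle (fun y : N ↦ TangentSpace J y)] [FiniteDimensional ℝ E']
    [IsContMDiffRiemannianBundle J ∞ E' (fun y : N ↦ TangentSpace J y)]
    {S : AlmostContactMetricStructure I M} (hF : IsAntiInvariantRiemannianSubmersion I J F S)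
    {p : M} (hker : (verticalSpace I J F p).map
      (S.phi p : TangentSpace I p →ₗ[ℝ] TangentSpace I p) = horizontalSpace I J F p)
    (v : TangentSpace I p) :
    (∀ V, IsVerticalField I J F V → leviCivita I V p v ∈ verticalSpace I J F p) ↔
      ∀ V, IsVerticalField I J F V →
        (verticalSpace I J F p).starProjection (leviCivita I (S.phiField V) p v) = 0 := by
  constructor
  · intro h V hV
    rw [Submodule.starProjection_apply_eq_zero_iff]
    refine (Submodule.mem_orthogonal _ _).2 fun u hu ↦ ?_
    obtain ⟨U, hU, rfl⟩ := hF.isRiemannianSubmersion.exists_isVerticalField_eq hu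
    rw [inner_leviCivita_eq_neg hU (hV.phiField hF), neg_eq_zero]
    exact Submodule.inner_right_of_mem_orthogonal (h U hU) ((hV.phiField hF).mem p)
  · intro h V hV
    rw [← Submodule.orthogonal_orthogonal (verticalSpace I J F p)]
    refine (Submodule.mem_orthogonal' _ _).2 fun z hz ↦ ?_
    obtain ⟨u, hu, rfl⟩ := Submodule.mem_map.1 (hker.symm ▸ hz :
      z ∈ (verticalSpace I J F p).map (S.phi p : TangentSpace I p →ₗ[ℝ] TangentSpace I p))
    obtain ⟨U, hU, rfl⟩ := hF.isRiemannianSubmersion.exists_isVerticalField_eq hu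
    have h1 := inner_leviCivita_eq_neg hV (hU.phiField hF) p v
    have h2 := (Submodule.starProjection_apply_eq_zero_iff _).1 (h U hU)
    rw [Submodule.inner_right_of_mem_orthogonal (hV.mem p) h2] at h1
    exact neg_eq_zero.1 h1.symm

/-- O'Neill's tensors vanish on the fields `φ V`, for `V` vertical, if and only if the vertical
parts of the covariant derivatives of these fields do. -/
theorem oneill_phiField_eq_zero_iff [T2Space M]
    [RiemannianBundle (fun y : N ↦ TangentSpace J y)] [FiniteDimensional ℝ E']
    [IsContMDiffRiemannianBundle J ∞ E' (fun y : N ↦ TangentSpace J y)]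
    {S : AlmostContactMetricStructure I M} (hF : IsAntiInvariantRiemannianSubmersion I J F S) :
    ((∀ W V, IsVerticalField I J F W → IsVerticalField I J F V →
        oneillT I J F W (S.phiField V) = 0) ∧
      ∀ X W, IsHorizontalField I J F X → IsVerticalField I J F W →
        oneillA I J F X (S.phiField W) = 0) ↔
      ∀ (p : M) (v : TangentSpace I p) V, IsVerticalField I J F V →
        (verticalSpace I J F p).starProjection (leviCivita I (S.phiField V) p v) = 0 := by
  constructor
  · rintro ⟨hT, hA⟩ p v V hV
    obtain ⟨W, hW, hWp⟩ := hF.isRiemannianSubmersion.exists_isVerticalField_eq (p := p)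
      (v := (verticalSpace I J F p).starProjection v) (Submodule.starProjection_apply_mem _ _)
    obtain ⟨X, hX, hXp⟩ := hF.isRiemannianSubmersion.exists_isHorizontalField_eq (p := p)
      (v := (horizontalSpace I J F p).starProjection v) (Submodule.starProjection_apply_mem _ _)
    have h1 := congrFun (hT W V hW hV) p
    have h2 := congrFun (hA X V hX hV) p
    rw [oneillT_apply_of_isHorizontalField hW (hV.phiField hF), hWp] at h1
    rw [oneillA_apply_of_isHorizontalField hX (hV.phiField hF), hXp] at h2
    have hv : (verticalSpace I J F p).starProjection v +
        (horizontalSpace I J F p).starProjection v = v :=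
      Submodule.starProjection_add_starProjection_orthogonal (K := verticalSpace I J F p) v
    rw [← hv, map_add, map_add, h1, h2]
    exact add_zero 0
  · intro h
    refine ⟨fun W V hW hV ↦ funext fun p ↦ ?_, fun X W hX hW ↦ funext fun p ↦ ?_⟩
    · rw [oneillT_apply_of_isHorizontalField hW (hV.phiField hF), h p _ V hV]
      rfl
    · rw [oneillA_apply_of_isHorizontalField hX (hW.phiField hF), h p _ W hW]
      rfl

end ONeillTensors

end RiemGeom

end

open RiemGeom in
theorem theorem6 (m n : ℕ)
    {M : Type*} [TopologicalSpace M] [T2Space M]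
    [ChartedSpace (EuclideanSpace ℝ (Fin (2 * m + 1))) M] [IsManifold (𝓡 (2 * m + 1)) ∞ M]
    [RiemannianBundle (fun x : M ↦ TangentSpace (𝓡 (2 * m + 1)) x)]
    [IsContMDiffRiemannianBundle (𝓡 (2 * m + 1)) ∞ (EuclideanSpace ℝ (Fin (2 * m + 1)))
      (fun x : M ↦ TangentSpace (𝓡 (2 * m + 1)) x)]
    {N : Type*} [TopologicalSpace N] [T2Space N]
    [ChartedSpace (EuclideanSpace ℝ (Fin n)) N] [IsManifold (𝓡 n) ∞ N]
    [RiemannianBundle (fun y : N ↦ TangentSpace (𝓡 n) y)]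
    [IsContMDiffRiemannianBundle (𝓡 n) ∞ (EuclideanSpace ℝ (Fin n))
      (fun y : N ↦ TangentSpace (𝓡 n) y)]
    (S : AlmostContactMetricStructure (𝓡 (2 * m + 1)) M) (hS : S.IsCosymplectic)
    (F : M → N)
    (hF : IsAntiInvariantRiemannianSubmersion (𝓡 (2 * m + 1)) (𝓡 n) F S)
    (hker : ∀ x : M, (verticalSpace (𝓡 (2 * m + 1)) (𝓡 n) F x).map
        (S.phi x : TangentSpace (𝓡 (2 * m + 1)) x →ₗ[ℝ] TangentSpace (𝓡 (2 * m + 1)) x) =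
      horizontalSpace (𝓡 (2 * m + 1)) (𝓡 n) F x) :
    IsTotallyGeodesicMap (𝓡 (2 * m + 1)) (𝓡 n) F ↔
      (∀ W V : Π x : M, TangentSpace (𝓡 (2 * m + 1)) x,
        IsVerticalField (𝓡 (2 * m + 1)) (𝓡 n) F W →
        IsVerticalField (𝓡 (2 * m + 1)) (𝓡 n) F V →
        oneillT (𝓡 (2 * m + 1)) (𝓡 n) F W (S.phiField V) = 0) ∧
      (∀ X W : Π x : M, TangentSpace (𝓡 (2 * m + 1)) x,
        IsHorizontalField (𝓡 (2 * m + 1)) (𝓡 n) F X →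
        IsVerticalField (𝓡 (2 * m + 1)) (𝓡 n) F W →
        oneillA (𝓡 (2 * m + 1)) (𝓡 n) F X (S.phiField W) = 0) := by
  rw [hF.isRiemannianSubmersion.isTotallyGeodesicMap_iff, oneill_phiField_eq_zero_iff hF]
  exact ⟨fun h p v ↦ (leviCivita_mem_verticalSpace_iff hF (hker p) v).1 fun V hV ↦ h V hV p v,
    fun h V hV p v ↦ (leviCivita_mem_verticalSpace_iff hF (hker p) v).2 (h p v) V hV⟩
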